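/- Let $a,x\in\mathbb{C}$ with $a\neq 0$ and $|x|<1$. Write $(A;q)_n=\prod_{k=0}^{n-1}(1-Aq^k)$, $(A;q)_\infty=\prod_{k=0}^{\infty}(1-Aq^k)$, and $(A_1,\dots,A_r;q)_n=(A_1;q)_n\cdots(A_r;q)_n$ for $n\in\mathbb{N}\cup\{\infty\}$. Let $f(u,v)=\sum_{j=-\infty}^{\infty}u^{j(j+1)/2}v^{j(j-1)/2}$ be Ramanujan's theta function and $\psi(q)=f(q,q^3)$. Then $(x;x^2)_{n+1}(x^4;x^4)_n\neq 0$ for all $n\ge 0$, $\psi(-x)\neq 0$, the series below converges absolutely, and $$(1+a)\sum_{n=0}^{\infty}\frac{(-ax,-x/a;x^2)_n\,x^{n^2+2n}}{(x;x^2)_{n+1}(x^4;x^4)_n}=\frac{(-a,-x^4/a,x^4;x^4)_\infty}{\psi(-x)}.$$ -/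

import Mathlib

/-- The finite rising `q`-factorial `(A; q)_n = (1 - A)(1 - A q) ⋯ (1 - A q ^ (n - 1))`. -/
def qFac (A q : ℂ) (n : ℕ) : ℂ := ∏ k ∈ Finset.range n, (1 - A * q ^ k)

/-- The infinite rising `q`-factorial `(A; q)_∞ = (1 - A)(1 - A q)(1 - A q ^ 2) ⋯`. -/
noncomputable def qFacInf (A q : ℂ) : ℂ := ∏' k : ℕ, (1 - A * q ^ k)

/-- The product defining `(A; q)_∞` converges when `|q| < 1`. -/
theorem qFacInf_multipliable (A q : ℂ) (hq : ‖q‖ < 1) :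
    Multipliable (fun k : ℕ => 1 - A * q ^ k) := by
  have h : Summable (fun k : ℕ => ‖-(A * q ^ k)‖) := by
    simp only [norm_neg, norm_mul, norm_pow]
    exact (summable_geometric_of_lt_one (norm_nonneg q) hq).mul_left _
  simpa [sub_eq_add_neg] using multipliable_one_add_of_summable h

/-- `(A; q)_n = (A; q)_∞ / (A q ^ n; q)_∞`, with the denominator cleared because it may vanish. -/
theorem qFac_mul_qFacInf (A q : ℂ) (hq : ‖q‖ < 1) (n : ℕ) :
    qFac A q n * qFacInf (A * q ^ n) q = qFacInf A q := by
  induction n with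
  | zero => simp [qFac]
  | succ n ih =>
    have step : ∀ B : ℂ, qFacInf B q = (1 - B) * qFacInf (B * q) q := by
      intro B
      have h := qFacInf_multipliable (B * q) q hq
      have e : (fun k : ℕ => 1 - B * q * q ^ k) = fun k : ℕ => 1 - B * q ^ (k + 1) := by
        funext k; ring
      rw [e] at h
      have h2 := tprod_eq_zero_mul' (f := fun k : ℕ => 1 - B * q ^ k) h
      simp only [pow_zero, mul_one] at h2
      rw [qFacInf, qFacInf, e]
      exact h2
    have h3 := step (A * q ^ n)
    have h4 : qFac A q (n + 1) = qFac A q n * (1 - A * q ^ n) := Finset.prod_range_succ _ _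
    rw [← ih, h3, h4, pow_succ, mul_assoc, mul_assoc A]

/-- Ramanujan's theta function
`f(a, b) = ∑_{j = -∞}^{∞} a ^ (j (j + 1) / 2) * b ^ (j (j - 1) / 2)`.
Both exponents are nonnegative integers, so the divisions are exact. -/
noncomputable def ramanujanTheta (a b : ℂ) : ℂ :=
  ∑' j : ℤ, a ^ (j * (j + 1) / 2) * b ^ (j * (j - 1) / 2)

/-- Ramanujan's `ψ(q) = f(q, q ^ 3)`. -/
noncomputable def ramanujanPsi (q : ℂ) : ℂ := ramanujanTheta q (q ^ 3)

/-! Write q for x. The finite triple product (`hasSum_finite_tripleProduct`) makes (-aq, -q/a; q²)_n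
a Laurent polynomial in a with Gaussian binomial coefficients. After multiplication by 1 + a,
neighbouring coefficients merge and release a factor 1 - q^(2n+1), which cancels the last factor of
(q; q²)_{n+1} (`hasSum_row`).

Absolute convergence (`summable_double`) permits summing over n first, with j fixed. That sum is a
limiting q-Gauss sum (`hasSum_qGaussTerm`) and equals q^(2j²-2j) / ψ(-q) (`hasSum_baileyTerm`,
`ramanujanPsi_neg`). The remaining series ∑ a^j q^(2j²-2j) is the Jacobi triple product in base q²
at a/q². Negative powers of q occur, so q = 0 is treated apart. -/

open Filter Topology

/-! ### q-factorials: recurrences, limits, bounds -/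

theorem qFac_zero (A q : ℂ) : qFac A q 0 = 1 := by simp [qFac]

theorem qFac_succ (A q : ℂ) (n : ℕ) : qFac A q (n + 1) = qFac A q n * (1 - A * q ^ n) :=
  Finset.prod_range_succ _ _

theorem qFac_succ' (A q : ℂ) (n : ℕ) : qFac A q (n + 1) = (1 - A) * qFac (A * q) q n := by
  simp only [qFac, Finset.prod_range_succ']
  rw [mul_comm]
  simp only [pow_zero, mul_one, pow_succ']
  congr 1
  exact Finset.prod_congr rfl fun k _ => by ring

theorem qFac_add (A q : ℂ) (m n : ℕ) :
    qFac A q (m + n) = qFac A q m * qFac (A * q ^ m) q n := by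
  simp only [qFac, Finset.prod_range_add]
  congr 1
  exact Finset.prod_congr rfl fun k _ => by ring

theorem qFac_tendsto (A q : ℂ) (hq : ‖q‖ < 1) :
    Tendsto (qFac A q) atTop (𝓝 (qFacInf A q)) :=
  (qFacInf_multipliable A q hq).tendsto_prod_tprod_nat

theorem qFac_ne_zero {A q : ℂ} {n : ℕ} (h : ∀ k < n, A * q ^ k ≠ 1) : qFac A q n ≠ 0 :=
  Finset.prod_ne_zero_iff.2 fun k hk => sub_ne_zero.2 (h k (Finset.mem_range.1 hk)).symm

theorem mul_pow_ne_one {A q : ℂ} (hA : ‖A‖ < 1) (hq : ‖q‖ < 1) (k : ℕ) : A * q ^ k ≠ 1 := by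
  intro h
  have h1 : ‖A‖ * ‖q‖ ^ k = 1 := by rw [← norm_pow, ← norm_mul, h, norm_one]
  have h2 : ‖q‖ ^ k ≤ 1 := pow_le_one₀ (norm_nonneg _) hq.le
  nlinarith [norm_nonneg A]

theorem qFacInf_ne_zero {A q : ℂ} (hq : ‖q‖ < 1) (h : ∀ k, A * q ^ k ≠ 1) :
    qFacInf A q ≠ 0 := by
  have hs : Summable (fun k : ℕ => ‖-(A * q ^ k)‖) := by
    simp only [norm_neg, norm_mul, norm_pow]
    exact (summable_geometric_of_lt_one (norm_nonneg q) hq).mul_left _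
  have := tprod_one_add_ne_zero_of_summable (f := fun k : ℕ => -(A * q ^ k))
    (fun k => by simpa [← sub_eq_add_neg, sub_eq_zero] using (h k).symm) hs
  simpa [qFacInf, ← sub_eq_add_neg] using this

theorem Filter.Tendsto.exists_norm_le {u : ℕ → ℂ} {l : ℂ} (h : Tendsto u atTop (𝓝 l)) :
    ∃ C, 0 ≤ C ∧ ∀ n, ‖u n‖ ≤ C := by
  obtain ⟨C, hC⟩ := h.norm.bddAbove_range
  have hC' : ∀ n, ‖u n‖ ≤ C := fun n => hC ⟨n, rfl⟩
  exact ⟨C, (norm_nonneg _).trans (hC' 0), hC'⟩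

theorem qFac_bounded (A : ℂ) {q : ℂ} (hq : ‖q‖ < 1) : ∃ C, 0 ≤ C ∧ ∀ n, ‖qFac A q n‖ ≤ C :=
  (qFac_tendsto A q hq).exists_norm_le

theorem qFac_inv_bounded {A q : ℂ} (hq : ‖q‖ < 1) (h : ∀ k, A * q ^ k ≠ 1) :
    ∃ C, 0 ≤ C ∧ ∀ n, ‖(qFac A q n)⁻¹‖ ≤ C :=
  ((qFac_tendsto A q hq).inv₀ (qFacInf_ne_zero hq h)).exists_norm_le

/-! ### Majorants with quadratic exponents -/

theorem summable_of_ratio_tendsto_zero {f u : ℕ → ℝ} (h : ∀ n, f (n + 1) = u n * f n)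
    (hu : Tendsto u atTop (𝓝 0)) : Summable f := by
  refine summable_of_ratio_norm_eventually_le (r := 1 / 2) (by norm_num) ?_
  have := hu.norm.eventually_le_const (u := 1 / 2) (by norm_num)
  filter_upwards [this] with n hn
  rw [h, norm_mul]
  exact mul_le_mul_of_nonneg_right hn (norm_nonneg _)

theorem tendsto_const_mul_pow_zero {c r : ℝ} (h0 : 0 ≤ r) (h1 : r < 1) :
    Tendsto (fun n : ℕ => c * r ^ n) atTop (𝓝 0) := by
  simpa using (tendsto_pow_atTop_nhds_zero_of_lt_one h0 h1).const_mul c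

theorem summable_pow_mul_pow_choose {c r : ℝ} (h0 : 0 ≤ r) (h1 : r < 1) :
    Summable (fun n : ℕ => c ^ n * r ^ (n.choose 2)) := by
  refine summable_of_ratio_tendsto_zero (u := fun n => c * r ^ n) (fun n => ?_)
    (tendsto_const_mul_pow_zero h0 h1)
  rw [Nat.choose_succ_succ' n 1, Nat.choose_one_right]
  ring

theorem summable_pow_mul_pow_sq {c r : ℝ} (h0 : 0 ≤ r) (h1 : r < 1) :
    Summable (fun n : ℕ => c ^ n * r ^ (n ^ 2)) := by
  refine summable_of_ratio_tendsto_zero (u := fun n => (c * r) * (r ^ 2) ^ n) (fun n => ?_)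
    (tendsto_const_mul_pow_zero (by positivity) (by nlinarith))
  rw [← pow_mul]
  ring

theorem summable_zpow_mul_zpow_sq {c r : ℝ} (h0 : 0 ≤ r) (h1 : r < 1) :
    Summable (fun j : ℤ => c ^ j * r ^ (j ^ 2)) := by
  refine Summable.of_nat_of_neg ?_ ?_
  · refine (summable_pow_mul_pow_sq (c := c) h0 h1).congr fun n => ?_
    norm_cast
  · refine (summable_pow_mul_pow_sq (c := c⁻¹) h0 h1).congr fun n => ?_
    rw [neg_sq, zpow_neg, inv_pow]
    norm_cast

/-! ### Reciprocal q-factorials on the integers -/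

/-- The reciprocal `1 / (q; q)_k`, extended by zero to negative `k`. -/
noncomputable def qInvFac (q : ℂ) (k : ℤ) : ℂ := if k < 0 then 0 else (qFac q q k.toNat)⁻¹

theorem qInvFac_of_neg (q : ℂ) {k : ℤ} (hk : k < 0) : qInvFac q k = 0 := if_pos hk

theorem qInvFac_natCast (q : ℂ) (n : ℕ) : qInvFac q n = (qFac q q n)⁻¹ := by
  simp [qInvFac]

/-- The extension by zero is consistent at k = 0 because 1 - q^0 vanishes, so later coefficient
comparisons need no boundary cases. -/
theorem qInvFac_pred {q : ℂ} (hq : ‖q‖ < 1) (k : ℤ) :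
    qInvFac q (k - 1) = (1 - q ^ k) * qInvFac q k := by
  rcases lt_trichotomy k 0 with h | h | h
  · rw [qInvFac_of_neg q h, qInvFac_of_neg q (by omega), mul_zero]
  · subst h
    rw [qInvFac_of_neg q (by omega)]
    simp
  · obtain ⟨n, rfl⟩ : ∃ n : ℕ, k = (n + 1 : ℕ) := ⟨k.toNat - 1, by omega⟩
    have e : ((n + 1 : ℕ) : ℤ) - 1 = n := by push_cast; ring
    rw [e, qInvFac_natCast, qInvFac_natCast, qFac_succ, zpow_natCast, pow_succ']
    have h1 : 1 - q * q ^ n ≠ 0 := sub_ne_zero.2 (mul_pow_ne_one hq hq n).symm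
    rw [mul_inv, mul_comm, mul_assoc, inv_mul_cancel₀ h1, mul_one]

theorem qInvFac_bounded {q : ℂ} (hq : ‖q‖ < 1) : ∃ C, 0 ≤ C ∧ ∀ k, ‖qInvFac q k‖ ≤ C := by
  obtain ⟨C, h0, hC⟩ := qFac_inv_bounded hq (mul_pow_ne_one hq hq)
  refine ⟨C, h0, fun k => ?_⟩
  unfold qInvFac
  split_ifs
  · simpa
  · exact hC _

theorem qInvFac_tendsto {q : ℂ} (hq : ‖q‖ < 1) (j : ℤ) :
    Tendsto (fun n : ℕ => qInvFac q (n + j)) atTop (𝓝 (qFacInf q q)⁻¹) := by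
  have h := ((qFac_tendsto q q hq).inv₀ (qFacInf_ne_zero hq (mul_pow_ne_one hq hq))).comp
    (tendsto_atTop_mono (f := fun n : ℕ => n - j.natAbs) (g := fun n : ℕ => ((n : ℤ) + j).toNat)
      (fun n => by omega) (tendsto_sub_atTop_nat _))
  refine h.congr' ?_
  filter_upwards [eventually_ge_atTop j.natAbs] with n hn
  simp only [Function.comp, qInvFac]
  rw [if_neg (by omega)]

/-! ### The Jacobi triple product -/

theorem norm_sq_lt_one {q : ℂ} (hq : ‖q‖ < 1) : ‖q ^ 2‖ < 1 := by
  rw [norm_pow]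
  exact pow_lt_one₀ (norm_nonneg _) hq two_ne_zero

theorem zpow_pred_sq {q : ℂ} (h0 : q ≠ 0) (j : ℤ) :
    q ^ ((j - 1) ^ 2) = q ^ (j ^ 2) * q / (q ^ j) ^ 2 := by
  rw [show (j - 1) ^ 2 = j ^ 2 + 1 - j * 2 by ring, zpow_sub₀ h0, zpow_add₀ h0, zpow_mul, zpow_one]
  norm_cast

theorem zpow_succ_sq {q : ℂ} (h0 : q ≠ 0) (j : ℤ) :
    q ^ ((j + 1) ^ 2) = q ^ (j ^ 2) * q * (q ^ j) ^ 2 := by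
  rw [show (j + 1) ^ 2 = j ^ 2 + 1 + j * 2 by ring, zpow_add₀ h0, zpow_add₀ h0, zpow_mul, zpow_one]
  norm_cast

theorem sq_zpow_natCast_add {q : ℂ} (h0 : q ≠ 0) (n : ℕ) (j : ℤ) :
    (q ^ 2) ^ ((n : ℤ) + j) = (q ^ n) ^ 2 * (q ^ j) ^ 2 := by
  rw [zpow_add₀ (pow_ne_zero 2 h0), zpow_natCast, ← pow_mul, ← pow_mul, mul_comm 2 n]
  congr 1
  rw [← zpow_natCast, ← zpow_natCast, ← zpow_mul, ← zpow_mul, mul_comm]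

theorem sq_zpow_natCast_sub {q : ℂ} (h0 : q ≠ 0) (n : ℕ) (j : ℤ) :
    (q ^ 2) ^ ((n : ℤ) - j) = (q ^ n) ^ 2 / (q ^ j) ^ 2 := by
  rw [sub_eq_add_neg, sq_zpow_natCast_add h0, zpow_neg, inv_pow, div_eq_mul_inv]

/-- The finite Jacobi triple product identity. -/
theorem hasSum_finite_tripleProduct {q a : ℂ} (h0 : q ≠ 0) (hq : ‖q‖ < 1) (ha : a ≠ 0) (n : ℕ) :
    HasSum (fun j : ℤ => qFac (q ^ 2) (q ^ 2) (2 * n) *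
        (qInvFac (q ^ 2) (n - j) * qInvFac (q ^ 2) (n + j)) * (a ^ j * q ^ (j ^ 2)))
      (qFac (-a * q) (q ^ 2) n * qFac (-q / a) (q ^ 2) n) := by
  have hQ := norm_sq_lt_one hq
  induction n with
  | zero =>
    have h := hasSum_single (f := fun j : ℤ => qFac (q ^ 2) (q ^ 2) (2 * 0) *
        (qInvFac (q ^ 2) ((0 : ℕ) - j) * qInvFac (q ^ 2) ((0 : ℕ) + j)) * (a ^ j * q ^ (j ^ 2))) 0
        (fun j hj => by
          rcases lt_or_gt_of_ne hj with h | h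
          · rw [qInvFac_of_neg (q ^ 2) (k := (0 : ℕ) + j) (by simpa using h)]; simp
          · rw [qInvFac_of_neg (q ^ 2) (k := (0 : ℕ) - j) (by simpa using h)]; simp)
    have e : qInvFac (q ^ 2) 0 = 1 := by simpa [qFac_zero] using qInvFac_natCast (q ^ 2) 0
    simpa [qFac_zero, e] using h
  | succ n ih =>
    have h1 := (Equiv.subRight (1 : ℤ)).hasSum_iff.2 ih
    have h2 := (Equiv.addRight (1 : ℤ)).hasSum_iff.2 ih
    -- The new factor (1 + a q^(2n+1))(1 + q^(2n+1)/a) is expanded in powers of a; its a and 1/a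
    -- parts act as shifts of j.
    have h := ((ih.mul_left (1 + q ^ (4 * n + 2))).add (h1.mul_left (a * q ^ (2 * n + 1)))).add
      (h2.mul_left (q ^ (2 * n + 1) / a))
    refine (congrArg₂ (fun f s => HasSum f s) (funext fun j => ?_) ?_).mpr h
    · simp only [Function.comp, Equiv.subRight_apply, Equiv.coe_addRight]
      have hv : q ^ j ≠ 0 := zpow_ne_zero _ h0
      have e1 := qInvFac_pred hQ (((n + 1 : ℕ) : ℤ) - j)
      have e2 := qInvFac_pred hQ (((n + 1 : ℕ) : ℤ) + j)
      have e3 := qInvFac_pred hQ ((n : ℤ) - j)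
      have e4 := qInvFac_pred hQ ((n : ℤ) + j)
      rw [sq_zpow_natCast_sub h0] at e1 e3
      rw [sq_zpow_natCast_add h0] at e2 e4
      rw [show ((n + 1 : ℕ) : ℤ) - j - 1 = n - j by push_cast; ring] at e1
      rw [show ((n + 1 : ℕ) : ℤ) + j - 1 = n + j by push_cast; ring] at e2
      rw [show (n : ℤ) - (j - 1) = (n + 1 : ℕ) - j by push_cast; ring,
        show (n : ℤ) + (j + 1) = (n + 1 : ℕ) + j by push_cast; ring,
        show (n : ℤ) + (j - 1) = n + j - 1 by ring, show (n : ℤ) - (j + 1) = n - j - 1 by ring,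
        e3, e4, e1, e2, zpow_pred_sq h0, zpow_succ_sq h0, zpow_sub_one₀ ha, zpow_add_one₀ ha,
        show 2 * (n + 1) = 2 * n + 1 + 1 by ring, qFac_succ, qFac_succ]
      generalize qInvFac (q ^ 2) ((n + 1 : ℕ) - j) = X
      generalize qInvFac (q ^ 2) ((n + 1 : ℕ) + j) = Y
      generalize qFac (q ^ 2) (q ^ 2) (2 * n) = Z
      generalize q ^ j = v at *
      generalize a ^ j = b
      generalize q ^ (j ^ 2) = c
      field_simp
      ring
    · rw [qFac_succ, qFac_succ]
      field_simp
      ring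

/-- The Jacobi triple product identity. -/
theorem hasSum_tripleProduct {q a : ℂ} (h0 : q ≠ 0) (hq : ‖q‖ < 1) (ha : a ≠ 0) :
    HasSum (fun j : ℤ => a ^ j * q ^ (j ^ 2))
      (qFacInf (-a * q) (q ^ 2) * qFacInf (-q / a) (q ^ 2) * qFacInf (q ^ 2) (q ^ 2)) := by
  have hQ := norm_sq_lt_one hq
  have hP : qFacInf (q ^ 2) (q ^ 2) ≠ 0 := qFacInf_ne_zero hQ (mul_pow_ne_one hQ hQ)
  have hs : Summable (fun j : ℤ => ‖a ^ j * q ^ (j ^ 2)‖) := by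
    simpa using summable_zpow_mul_zpow_sq (c := ‖a‖) (norm_nonneg q) hq
  obtain ⟨C, hC0, hC⟩ := qFac_bounded (q ^ 2) hQ
  obtain ⟨D, hD0, hD⟩ := qInvFac_bounded hQ
  have h2n : Tendsto (fun n : ℕ => 2 * n) atTop atTop :=
    tendsto_id.const_mul_atTop' (by norm_num)
  -- As n → ∞, (q²; q²)_{2n} cancels one of the two reciprocals in the limit, leaving a single
  -- 1/(q²; q²)_∞.
  have hlim := tendsto_tsum_of_dominated_convergence
    (f := fun (n : ℕ) (j : ℤ) => qFac (q ^ 2) (q ^ 2) (2 * n) *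
        (qInvFac (q ^ 2) (n - j) * qInvFac (q ^ 2) (n + j)) * (a ^ j * q ^ (j ^ 2)))
    (g := fun j : ℤ => (qFacInf (q ^ 2) (q ^ 2))⁻¹ * (a ^ j * q ^ (j ^ 2)))
    (bound := fun j : ℤ => C * (D * D) * ‖a ^ j * q ^ (j ^ 2)‖) (𝓕 := atTop)
    (hs.mul_left _)
    (fun j => by
      have := (((qFac_tendsto (q ^ 2) (q ^ 2) hQ).comp h2n).mul
        ((qInvFac_tendsto hQ (-j)).mul (qInvFac_tendsto hQ j))).mul_const (a ^ j * q ^ (j ^ 2))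
      rwa [mul_inv_cancel_left₀ hP] at this)
    (Eventually.of_forall fun n j => by
      rw [norm_mul, norm_mul, norm_mul (qInvFac _ _)]
      gcongr
      · exact hC _
      · exact hD _
      · exact hD _)
  simp only [(hasSum_finite_tripleProduct h0 hq ha _).tsum_eq] at hlim
  have hlim' := (qFac_tendsto (-a * q) (q ^ 2) hQ).mul (qFac_tendsto (-q / a) (q ^ 2) hQ)
  have e := tendsto_nhds_unique hlim' hlim
  rw [tsum_mul_left] at e
  rw [e, mul_comm, mul_inv_cancel_left₀ hP]
  exact hs.of_norm.hasSum

/-! ### Product dissections and the product for ψ(-x) -/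

theorem qFac_mul_neg (A q : ℂ) (n : ℕ) :
    qFac A q n * qFac (-A) q n = qFac (A ^ 2) (q ^ 2) n := by
  simp only [qFac, ← Finset.prod_mul_distrib]
  exact Finset.prod_congr rfl fun k _ => by ring

theorem qFac_two_mul (A q : ℂ) (n : ℕ) :
    qFac A q (2 * n) = qFac A (q ^ 2) n * qFac (A * q) (q ^ 2) n := by
  induction n with
  | zero => simp [qFac_zero]
  | succ n ih =>
    rw [show 2 * (n + 1) = 2 * n + 1 + 1 by ring, qFac_succ, qFac_succ, ih, qFac_succ, qFac_succ]
    ring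

theorem qFacInf_eq_mul (A : ℂ) {q : ℂ} (hq : ‖q‖ < 1) :
    qFacInf A q = qFacInf A (q ^ 2) * qFacInf (A * q) (q ^ 2) := by
  have hQ := norm_sq_lt_one hq
  have h2n : Tendsto (fun n : ℕ => 2 * n) atTop atTop :=
    tendsto_id.const_mul_atTop' (by norm_num)
  refine tendsto_nhds_unique ((qFac_tendsto A q hq).comp h2n) ?_
  exact Tendsto.congr (fun n => (qFac_two_mul A q n).symm)
    ((qFac_tendsto _ _ hQ).mul (qFac_tendsto _ _ hQ))

theorem qFac_sq_two_mul (q : ℂ) (n : ℕ) :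
    qFac (q ^ 2) (q ^ 2) (2 * n) =
      qFac q (q ^ 2) n * qFac (-q) (q ^ 2) n * qFac (q ^ 4) (q ^ 4) n := by
  rw [qFac_two_mul, qFac_mul_neg]
  ring_nf

theorem qFacInf_sq {q : ℂ} (hq : ‖q‖ < 1) :
    qFacInf (q ^ 2) (q ^ 2) =
      qFacInf q (q ^ 2) * qFacInf (-q) (q ^ 2) * qFacInf (q ^ 4) (q ^ 4) := by
  have hQ := norm_sq_lt_one hq
  have hQ4 : ‖q ^ 4‖ < 1 := by
    rw [norm_pow]; exact pow_lt_one₀ (norm_nonneg _) hq (by norm_num)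
  have h2n : Tendsto (fun n : ℕ => 2 * n) atTop atTop :=
    tendsto_id.const_mul_atTop' (by norm_num)
  refine tendsto_nhds_unique ((qFac_tendsto (q ^ 2) (q ^ 2) hQ).comp h2n) ?_
  refine Tendsto.congr (fun n => (qFac_sq_two_mul q n).symm) ?_
  exact ((qFac_tendsto _ _ hQ).mul (qFac_tendsto _ _ hQ)).mul (qFac_tendsto _ _ hQ4)

theorem ramanujanPsi_neg {x : ℂ} (h0 : x ≠ 0) (hx : ‖x‖ < 1) :
    ramanujanPsi (-x) = qFacInf x (x ^ 2) * qFacInf (x ^ 4) (x ^ 4) := by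
  have h := hasSum_tripleProduct (q := x ^ 2) (a := -x⁻¹) (pow_ne_zero 2 h0) (norm_sq_lt_one hx)
    (by simpa)
  have e : ∀ j : ℤ, (-x) ^ (j * (j + 1) / 2) * ((-x) ^ 3) ^ (j * (j - 1) / 2) =
      (-x⁻¹) ^ j * (x ^ 2) ^ (j ^ 2) := by
    intro j
    obtain ⟨k, hk⟩ : Even (j * (j - 1)) := Int.even_mul_pred_self j
    have hn : -x ≠ 0 := neg_ne_zero.2 h0
    -- With k = j(j-1)/2 the total exponent of -x is (k + j) + 3k = 2j² - j.
    rw [show j * (j - 1) / 2 = k by omega,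
      show j * (j + 1) / 2 = k + j by
        have : j * (j + 1) = j * (j - 1) + 2 * j := by ring
        omega,
      show -x⁻¹ = (-x) ^ (-1 : ℤ) by rw [zpow_neg_one, inv_neg],
      show x ^ 2 = (-x) ^ (2 : ℤ) by rw [zpow_ofNat, neg_sq],
      show (-x) ^ 3 = (-x) ^ (3 : ℤ) by rw [zpow_ofNat],
      ← zpow_mul, ← zpow_mul, ← zpow_mul, ← zpow_add₀ hn, ← zpow_add₀ hn]
    congr 1
    nlinarith
  rw [ramanujanPsi, ramanujanTheta, tsum_congr e, h.tsum_eq, qFacInf_eq_mul x (norm_sq_lt_one hx)]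
  rw [show - -x⁻¹ * x ^ 2 = x by field_simp, show -x ^ 2 / -x⁻¹ = x * x ^ 2 by field_simp,
    show (x ^ 2) ^ 2 = x ^ 4 by ring]

/-! ### The limiting q-Gauss sum -/

/-- The terms of the limiting `q`-Gauss series
`∑ (A; q)_m q ^ (m (m - 1) / 2) (-D) ^ m / ((q; q)_m (A D; q)_m)`. -/
noncomputable def qGaussTerm (A D q : ℂ) (m : ℕ) : ℂ :=
  qFac A q m * (q ^ m.choose 2 * (-D) ^ m) * ((qFac q q m)⁻¹ * (qFac (A * D) q m)⁻¹)

/-- Uniformity in N comes from 1/(ADq^N; q)_m = (AD; q)_N / (AD; q)_{N+m}, a product of bounded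
quantities. -/
theorem qGaussTerm_bound {A D q : ℂ} (hq : ‖q‖ < 1) (hC : ∀ k, A * D * q ^ k ≠ 1) :
    ∃ C, 0 ≤ C ∧ ∀ N m,
      ‖qGaussTerm A (D * q ^ N) q m‖ ≤ C * (‖D * q ^ N‖ ^ m * ‖q‖ ^ m.choose 2) := by
  obtain ⟨C₁, h₁, hC₁⟩ := qFac_bounded A hq
  obtain ⟨C₂, h₂, hC₂⟩ := qFac_inv_bounded hq (mul_pow_ne_one hq hq)
  obtain ⟨C₃, h₃, hC₃⟩ := qFac_bounded (A * D) hq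
  obtain ⟨C₄, h₄, hC₄⟩ := qFac_inv_bounded hq hC
  refine ⟨C₁ * (C₂ * (C₃ * C₄)), by positivity, fun N m => ?_⟩
  have e : (qFac (A * (D * q ^ N)) q m)⁻¹ = qFac (A * D) q N * (qFac (A * D) q (N + m))⁻¹ := by
    rw [qFac_add, mul_inv, mul_inv_cancel_left₀ (qFac_ne_zero fun k _ => hC k), mul_assoc]
  rw [qGaussTerm, e]
  simp only [norm_mul, norm_pow, norm_neg]
  calc _ ≤ C₁ * (‖q‖ ^ m.choose 2 * (‖D‖ * ‖q‖ ^ N) ^ m) * (C₂ * (C₃ * C₄)) := by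
        gcongr
        · exact hC₁ _
        · exact hC₂ _
        · exact hC₃ _
        · exact hC₄ _
    _ = _ := by ring

theorem qGaussTerm_summable {A D q : ℂ} (hq : ‖q‖ < 1) (hC : ∀ k, A * D * q ^ k ≠ 1) :
    Summable (qGaussTerm A D q) := by
  obtain ⟨C, -, h⟩ := qGaussTerm_bound hq hC
  refine Summable.of_norm_bounded
    ((summable_pow_mul_pow_choose (c := ‖D‖) (norm_nonneg q) hq).mul_left C) fun m => ?_
  simpa using h 0 m

/-- The certificate (1 - q^m) t_m vanishes at m = 0, so summation over m yields the contiguous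
relation between D and Dq. -/
theorem qGaussTerm_telescope {A D q : ℂ} (hq : ‖q‖ < 1) (hC : ∀ k, A * D * q ^ k ≠ 1) (m : ℕ) :
    (1 - A * D) * qGaussTerm A D q m - (1 - D) * qGaussTerm A (D * q) q m =
      (1 - A * D) * ((1 - q ^ m) * qGaussTerm A D q m -
        (1 - q ^ (m + 1)) * qGaussTerm A D q (m + 1)) := by
  have h1 : qFac q q m ≠ 0 := qFac_ne_zero fun k _ => mul_pow_ne_one hq hq k
  have h2 : qFac (A * D) q m ≠ 0 := qFac_ne_zero fun k _ => hC k
  have h3 : 1 - A * D * q ^ m ≠ 0 := sub_ne_zero.2 (hC m).symm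
  have h4 : 1 - A * D ≠ 0 := sub_ne_zero.2 (by simpa using (hC 0).symm)
  have h5 : 1 - q * q ^ m ≠ 0 := sub_ne_zero.2 (mul_pow_ne_one hq hq m).symm
  have e : (qFac (A * (D * q)) q m)⁻¹ =
      (1 - A * D) * ((qFac (A * D) q m)⁻¹ * (1 - A * D * q ^ m)⁻¹) := by
    rw [← mul_inv, ← qFac_succ, qFac_succ', mul_inv, mul_inv_cancel_left₀ h4, mul_assoc]
  rw [qGaussTerm, qGaussTerm, qGaussTerm, e, qFac_succ, qFac_succ, qFac_succ,
    Nat.choose_succ_succ' m 1, Nat.choose_one_right, one_add_one_eq_two, pow_succ' q m, pow_add q m, pow_succ (-D), ← neg_mul, mul_pow (-D)]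
  generalize qFac q q m = X at *
  generalize qFac (A * D) q m = Y at *
  generalize q ^ m.choose 2 = Z at *
  generalize q ^ m = u at *
  generalize (-D) ^ m = w at *
  rw [mul_inv X, mul_inv Y]
  have h6 : (1 - q * u) * (1 - q * u)⁻¹ = 1 := mul_inv_cancel₀ h5
  generalize (1 - q * u)⁻¹ = r at *
  field_simp
  linear_combination (qFac A q m * Z * w * A * D * u ^ 2 - qFac A q m * Z * w * D * u) * h6

theorem tsum_qGaussTerm_step {A D q : ℂ} (hq : ‖q‖ < 1) (hC : ∀ k, A * D * q ^ k ≠ 1) :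
    (1 - A * D) * ∑' m, qGaussTerm A D q m = (1 - D) * ∑' m, qGaussTerm A (D * q) q m := by
  have hC' : ∀ k, A * (D * q) * q ^ k ≠ 1 := fun k => by
    have := hC (k + 1)
    rwa [pow_succ', ← mul_assoc, mul_assoc A D q] at this
  have s1 := qGaussTerm_summable hq hC
  have s2 := qGaussTerm_summable hq hC'
  have sG : Summable fun m => (1 - q ^ m) * qGaussTerm A D q m := by
    refine Summable.of_norm_bounded (s1.norm.mul_left 2) fun m => ?_
    rw [norm_mul]
    gcongr
    refine (norm_sub_le _ _).trans ?_
    have : ‖q ^ m‖ ≤ 1 := by rw [norm_pow]; exact pow_le_one₀ (norm_nonneg _) hq.le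
    rw [norm_one]
    linarith
  have sG' := (summable_nat_add_iff 1).2 sG
  have h0 := sG.tsum_eq_zero_add
  simp only [pow_zero, sub_self, zero_mul, zero_add] at h0
  rw [← sub_eq_zero, ← tsum_mul_left, ← tsum_mul_left,
    ← (s1.mul_left _).tsum_sub (s2.mul_left _), tsum_congr (qGaussTerm_telescope hq hC),
    tsum_mul_left, sG.tsum_sub sG', h0, sub_self, mul_zero]

theorem tsum_qGaussTerm_iterate {A D q : ℂ} (hq : ‖q‖ < 1) (hC : ∀ k, A * D * q ^ k ≠ 1) (N : ℕ) :
    qFac (A * D) q N * ∑' m, qGaussTerm A D q m =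
      qFac D q N * ∑' m, qGaussTerm A (D * q ^ N) q m := by
  induction N with
  | zero => simp [qFac_zero]
  | succ N ih =>
    have hC' : ∀ k, A * (D * q ^ N) * q ^ k ≠ 1 := fun k => by
      have := hC (N + k)
      rwa [pow_add, ← mul_assoc, mul_assoc A D] at this
    have h := tsum_qGaussTerm_step hq hC'
    rw [qFac_succ, qFac_succ, mul_right_comm, ih, pow_succ, ← mul_assoc D, mul_assoc (qFac D q N),
      mul_assoc (qFac D q N), ← h]
    ring

/-- The limiting case `B → ∞` of the `q`-Gauss summation. -/
theorem hasSum_qGaussTerm {A D q : ℂ} (hq : ‖q‖ < 1) (hC : ∀ k, A * D * q ^ k ≠ 1) :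
    HasSum (qGaussTerm A D q) (qFacInf D q / qFacInf (A * D) q) := by
  obtain ⟨C, hC0, hb⟩ := qGaussTerm_bound hq hC
  have hD : Tendsto (fun N : ℕ => ‖D * q ^ N‖) atTop (𝓝 0) := by
    simpa using tendsto_const_mul_pow_zero (c := ‖D‖) (norm_nonneg q) hq
  -- Since D q^N → 0, only the term m = 0 survives.
  have hlim : Tendsto (fun N : ℕ => ∑' m, qGaussTerm A (D * q ^ N) q m) atTop
      (𝓝 (∑' m, if m = 0 then 1 else 0)) := by
    refine tendsto_tsum_of_dominated_convergence
      (bound := fun m => C * (‖D‖ ^ m * ‖q‖ ^ m.choose 2))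
      ((summable_pow_mul_pow_choose (norm_nonneg q) hq).mul_left C) (fun m => ?_)
      (Eventually.of_forall fun N m => (hb N m).trans ?_)
    · split_ifs with hm
      · subst hm
        simp [qGaussTerm, qFac_zero]
      · refine squeeze_zero_norm (fun N => hb N m) ?_
        simpa [hm] using ((hD.pow m).mul_const (‖q‖ ^ m.choose 2)).const_mul C
    · gcongr
      rw [norm_mul, norm_pow]
      exact mul_le_of_le_one_right (norm_nonneg _) (pow_le_one₀ (norm_nonneg _) hq.le)
  rw [tsum_ite_eq] at hlim
  have h1 := (qFac_tendsto (A * D) q hq).mul_const (∑' m, qGaussTerm A D q m)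
  have h2 := (qFac_tendsto D q hq).mul hlim
  simp only [tsum_qGaussTerm_iterate hq hC] at h1
  have e := tendsto_nhds_unique h1 h2
  rw [mul_one] at e
  rw [← e, mul_div_cancel_left₀ _ (qFacInf_ne_zero hq hC)]
  exact (qGaussTerm_summable hq hC).hasSum

/-! ### The sum over n for fixed j -/

theorem sq_add_choose_two (m : ℕ) : m + 2 * m.choose 2 = m ^ 2 := by
  induction m with
  | zero => rfl
  | succ m ih =>
    rw [Nat.choose_succ_succ' m 1, Nat.choose_one_right]
    ring_nf at ih ⊢
    omega

theorem hasSum_baileyTerm_nat {q : ℂ} (hq : ‖q‖ < 1) (i : ℕ) :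
    HasSum (fun n : ℕ => (q ^ i ^ 2 + q ^ (i + 1) ^ 2) * (q ^ (n ^ 2 + 2 * n) *
        qFac (-q) (q ^ 2) n * (qInvFac (q ^ 2) (n - i) * qInvFac (q ^ 2) (n + 1 + i))))
      (q ^ (2 * i ^ 2 + 2 * i) * (qFacInf (-q) (q ^ 2) / qFacInf (q ^ 2) (q ^ 2))) := by
  have hQ := norm_sq_lt_one hq
  -- Terms with n < i vanish; put n = i + m.
  rw [← hasSum_nat_add_iff' i, Finset.sum_eq_zero (fun n hn => by
    rw [qInvFac_of_neg _ (k := (n : ℤ) - i) (by have := Finset.mem_range.1 hn; omega)]; simp),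
    sub_zero]
  -- The q-Gauss parameters in base q² are A = -q^(2i+1) and D = -q^(2i+3).
  have eAD : -q * (q ^ 2) ^ i * (-q * (q ^ 2) ^ (i + 1)) = q ^ 2 * (q ^ 2) ^ (2 * i + 1) := by ring
  have hC : ∀ k, -q * (q ^ 2) ^ i * (-q * (q ^ 2) ^ (i + 1)) * (q ^ 2) ^ k ≠ 1 := fun k => by
    rw [eAD, mul_assoc, ← pow_add]
    exact mul_pow_ne_one hQ hQ _
  have hP : qFacInf (q ^ 2) (q ^ 2) ≠ 0 := qFacInf_ne_zero hQ (mul_pow_ne_one hQ hQ)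
  have hF : qFac (q ^ 2) (q ^ 2) (2 * i + 1) ≠ 0 :=
    qFac_ne_zero fun k _ => mul_pow_ne_one hQ hQ k
  have h := (hasSum_qGaussTerm hQ hC).mul_left ((q ^ i ^ 2 + q ^ (i + 1) ^ 2) *
    (q ^ (i ^ 2 + 2 * i) * qFac (-q) (q ^ 2) i * (qFac (q ^ 2) (q ^ 2) (2 * i + 1))⁻¹))
  refine (congrArg₂ (fun f s => HasSum f s) (funext fun m => ?_) ?_).mpr h
  · rw [qGaussTerm, eAD, show ((m + i : ℕ) : ℤ) - i = m by push_cast; ring,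
      show ((m + i : ℕ) : ℤ) + 1 + i = (2 * i + 1 + m : ℕ) by push_cast; ring,
      qInvFac_natCast, qInvFac_natCast, qFac_add (q ^ 2), add_comm m i, qFac_add (-q), mul_inv]
    have e : q ^ ((i + m) ^ 2 + 2 * (i + m)) =
        q ^ (i ^ 2 + 2 * i) * ((q ^ 2) ^ m.choose 2 * (-(-q * (q ^ 2) ^ (i + 1))) ^ m) := by
      have : -(-q * (q ^ 2) ^ (i + 1)) = q ^ (2 * i + 3) := by ring
      rw [this, ← pow_mul, ← pow_mul, ← pow_add, ← pow_add]
      congr 1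
      have := sq_add_choose_two m
      nlinarith
    rw [e]
    ring
  -- The prefactor q^(i²)(1 + q^(2i+1)) extends (-q; q²)_i to (-q; q²)_{i+1}, which completes (D;
  -- q²)_∞ to (-q; q²)_∞.
  · rw [eAD, ← qFac_mul_qFacInf (-q) (q ^ 2) hQ (i + 1), qFac_succ,
      ← qFac_mul_qFacInf (q ^ 2) (q ^ 2) hQ (2 * i + 1)]
    rw [← qFac_mul_qFacInf (q ^ 2) (q ^ 2) hQ (2 * i + 1)] at hP
    have hP' := right_ne_zero_of_mul hP
    field_simp
    ring

/-- The summand and the value are invariant under j ↦ 1 - j, which reduces all integers j to the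
case of a natural i. -/
theorem hasSum_baileyTerm {q : ℂ} (hq : ‖q‖ < 1) (j : ℤ) :
    HasSum (fun n : ℕ => (q ^ ((j - 1) ^ 2) + q ^ (j ^ 2)) * (q ^ (n ^ 2 + 2 * n) *
        qFac (-q) (q ^ 2) n * (qInvFac (q ^ 2) (n + 1 - j) * qInvFac (q ^ 2) (n + j))))
      (q ^ (2 * j ^ 2 - 2 * j) * (qFacInf (-q) (q ^ 2) / qFacInf (q ^ 2) (q ^ 2))) := by
  rcases le_or_gt j 0 with hj | hj
  · obtain ⟨i, rfl⟩ : ∃ i : ℕ, j = -i := ⟨j.natAbs, by omega⟩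
    have h := hasSum_baileyTerm_nat hq i
    rw [show 2 * (-(i : ℤ)) ^ 2 - 2 * -(i : ℤ) = (2 * i ^ 2 + 2 * i : ℕ) by push_cast; ring,
      show (-(i : ℤ) - 1) ^ 2 = ((i + 1) ^ 2 : ℕ) by push_cast; ring,
      show (-(i : ℤ)) ^ 2 = (i ^ 2 : ℕ) by push_cast; ring, zpow_natCast, zpow_natCast,
      zpow_natCast, add_comm (q ^ _)]
    simpa only [sub_neg_eq_add, ← sub_eq_add_neg, mul_comm (qInvFac _ (_ + _ + _))] using h
  · obtain ⟨i, rfl⟩ : ∃ i : ℕ, j = i + 1 := ⟨(j - 1).toNat, by omega⟩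
    have h := hasSum_baileyTerm_nat hq i
    rw [show 2 * ((i : ℤ) + 1) ^ 2 - 2 * ((i : ℤ) + 1) = (2 * i ^ 2 + 2 * i : ℕ) by
        push_cast; ring,
      show ((i : ℤ) + 1 - 1) ^ 2 = (i ^ 2 : ℕ) by push_cast; ring,
      show ((i : ℤ) + 1) ^ 2 = ((i + 1) ^ 2 : ℕ) by push_cast; ring, zpow_natCast, zpow_natCast,
      zpow_natCast]
    simpa only [add_sub_add_right_eq_sub, add_assoc, add_comm (1 : ℤ)] using h

/-! ### The double series -/

/-- Over a common denominator the coefficients merge by q^(j²)(1 - q^(2n+2-2j)) + q^((j-1)²)(1 -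
q^(2n+2j)) = (q^(j²) + q^((j-1)²))(1 - q^(2n+1)). -/
theorem hasSum_row {q a : ℂ} (h0 : q ≠ 0) (hq : ‖q‖ < 1) (ha : a ≠ 0) (n : ℕ) :
    HasSum (fun j : ℤ => a ^ j * ((q ^ ((j - 1) ^ 2) + q ^ (j ^ 2)) * (q ^ (n ^ 2 + 2 * n) *
        qFac (-q) (q ^ 2) n * (qInvFac (q ^ 2) (n + 1 - j) * qInvFac (q ^ 2) (n + j)))))
      ((1 + a) * (qFac (-a * q) (q ^ 2) n * qFac (-q / a) (q ^ 2) n * q ^ (n ^ 2 + 2 * n) /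
        (qFac q (q ^ 2) (n + 1) * qFac (q ^ 4) (q ^ 4) n))) := by
  have hQ := norm_sq_lt_one hq
  have hQ4 : ‖q ^ 4‖ < 1 := by
    rw [norm_pow]; exact pow_lt_one₀ (norm_nonneg _) hq (by norm_num)
  have h := hasSum_finite_tripleProduct h0 hq ha n
  have h1 := (Equiv.subRight (1 : ℤ)).hasSum_iff.2 h
  have h2 := (h.add (h1.mul_left a)).mul_left
    (q ^ (n ^ 2 + 2 * n) / (qFac q (q ^ 2) (n + 1) * qFac (q ^ 4) (q ^ 4) n))
  refine (congrArg₂ (fun f s => HasSum f s) (funext fun j => ?_) ?_).mpr h2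
  · simp only [Function.comp, Equiv.subRight_apply]
    have hv : q ^ j ≠ 0 := zpow_ne_zero _ h0
    have e1 := qInvFac_pred hQ (((n + 1 : ℕ) : ℤ) - j)
    have e4 := qInvFac_pred hQ ((n : ℤ) + j)
    rw [sq_zpow_natCast_sub h0] at e1
    rw [sq_zpow_natCast_add h0] at e4
    rw [show ((n + 1 : ℕ) : ℤ) - j - 1 = n - j by push_cast; ring] at e1
    have f1 : qFac q (q ^ 2) n ≠ 0 := qFac_ne_zero fun k _ => mul_pow_ne_one hq hQ k
    have f2 : qFac (q ^ 4) (q ^ 4) n ≠ 0 := qFac_ne_zero fun k _ => mul_pow_ne_one hQ4 hQ4 k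
    have f3 : 1 - q * (q ^ 2) ^ n ≠ 0 := sub_ne_zero.2 (mul_pow_ne_one hq hQ n).symm
    rw [show (n : ℤ) - (j - 1) = (n + 1 : ℕ) - j by push_cast; ring,
      show (n : ℤ) + 1 - j = (n + 1 : ℕ) - j by push_cast; ring,
      show (n : ℤ) + (j - 1) = n + j - 1 by ring, e4, e1, zpow_pred_sq h0, zpow_sub_one₀ ha,
      qFac_sq_two_mul, qFac_succ]
    generalize qInvFac (q ^ 2) ((n + 1 : ℕ) - j) = X
    generalize qInvFac (q ^ 2) (n + j) = Y
    generalize qFac (q ^ 4) (q ^ 4) n = Z at *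
    generalize qFac q (q ^ 2) n = U at *
    generalize qFac (-q) (q ^ 2) n = V at *
    generalize q ^ (n ^ 2 + 2 * n) = T at *
    generalize q ^ (j ^ 2) = c
    generalize q ^ j = v at *
    generalize a ^ j = b
    rw [pow_right_comm] at f3 ⊢
    rw [pow_succ q n]
    generalize q ^ n = u at *
    field_simp
    ring
  · ring

/-- Boundedness of the q-factorials leaves a majorant that separates into a function of n times a
function of j. -/
theorem summable_double {q a : ℂ} (h0 : q ≠ 0) (hq : ‖q‖ < 1) (ha : a ≠ 0) :
    Summable (Function.uncurry fun (n : ℕ) (j : ℤ) =>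
      a ^ j * ((q ^ ((j - 1) ^ 2) + q ^ (j ^ 2)) * (q ^ (n ^ 2 + 2 * n) *
        qFac (-q) (q ^ 2) n * (qInvFac (q ^ 2) (n + 1 - j) * qInvFac (q ^ 2) (n + j))))) := by
  have hQ := norm_sq_lt_one hq
  obtain ⟨C, hC0, hC⟩ := qFac_bounded (-q) hQ
  obtain ⟨D, hD0, hD⟩ := qInvFac_bounded hQ
  have s := (hasSum_tripleProduct h0 hq ha).summable
  have s1 := ((Equiv.subRight (1 : ℤ)).summable_iff.2 s).mul_left a
  have sj : Summable fun j : ℤ => ‖a ^ j * (q ^ ((j - 1) ^ 2) + q ^ (j ^ 2))‖ := by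
    refine ((s1.add s).congr fun j => ?_).norm
    simp only [Function.comp, Equiv.subRight_apply]
    rw [zpow_sub_one₀ ha]
    field_simp
  have sn : Summable fun n : ℕ => (‖q‖ ^ 2) ^ n * ‖q‖ ^ (n ^ 2) :=
    summable_pow_mul_pow_sq (norm_nonneg q) hq
  refine Summable.of_norm_bounded ((Summable.mul_of_nonneg sn sj (fun n => by positivity)
    (fun j => by positivity)).mul_left (C * (D * D))) ?_
  rintro ⟨n, j⟩
  simp only [Function.uncurry]
  calc _ = ‖a ^ j * (q ^ ((j - 1) ^ 2) + q ^ (j ^ 2))‖ * (‖q‖ ^ (n ^ 2 + 2 * n) *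
        ‖qFac (-q) (q ^ 2) n‖ *
        (‖qInvFac (q ^ 2) (n + 1 - j)‖ * ‖qInvFac (q ^ 2) (n + j)‖)) := by
        simp only [norm_mul, norm_pow]; ring
    _ ≤ ‖a ^ j * (q ^ ((j - 1) ^ 2) + q ^ (j ^ 2))‖ * (‖q‖ ^ (n ^ 2 + 2 * n) * C * (D * D)) := by
        gcongr
        · exact hC _
        · exact hD _
        · exact hD _
    _ = _ := by ring

theorem summable_series {a q : ℂ} (hq : ‖q‖ < 1) :
    Summable (fun n : ℕ =>
      qFac (-a * q) (q ^ 2) n * qFac (-q / a) (q ^ 2) n * q ^ (n ^ 2 + 2 * n) /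
        (qFac q (q ^ 2) (n + 1) * qFac (q ^ 4) (q ^ 4) n)) := by
  have hQ := norm_sq_lt_one hq
  have hQ4 : ‖q ^ 4‖ < 1 := by
    rw [norm_pow]; exact pow_lt_one₀ (norm_nonneg _) hq (by norm_num)
  obtain ⟨C₁, h₁, hC₁⟩ := qFac_bounded (-a * q) hQ
  obtain ⟨C₂, h₂, hC₂⟩ := qFac_bounded (-q / a) hQ
  obtain ⟨C₃, h₃, hC₃⟩ := qFac_inv_bounded hQ (mul_pow_ne_one hq hQ)
  obtain ⟨C₄, h₄, hC₄⟩ := qFac_inv_bounded hQ4 (mul_pow_ne_one hQ4 hQ4)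
  refine Summable.of_norm_bounded ((summable_pow_mul_pow_sq (c := ‖q‖ ^ 2) (norm_nonneg q)
    hq).mul_left (C₁ * C₂ * (C₃ * C₄))) fun n => ?_
  rw [div_eq_mul_inv, mul_inv]
  simp only [norm_mul]
  calc _ ≤ C₁ * C₂ * ‖q ^ (n ^ 2 + 2 * n)‖ * (C₃ * C₄) := by
        gcongr
        · exact hC₁ _
        · exact hC₂ _
        · exact hC₃ _
        · exact hC₄ _
    _ = _ := by rw [norm_pow]; ring

/-! ### The case x = 0 and the conclusion -/

theorem ramanujanPsi_zero : ramanujanPsi 0 = 1 := by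
  rw [ramanujanPsi, ramanujanTheta, tsum_eq_single 0]
  · simp
  · intro j hj
    have h1 : 0 ≤ j * (j - 1) := by
      rcases lt_or_gt_of_ne hj with h | h <;> nlinarith
    have h2 : j * (j + 1) = j * (j - 1) + 2 * j := by ring
    -- For j ≠ 0 at least one of the two halved exponents is nonzero, which kills the term.
    have h3 : j * (j - 1) + 2 * j ≥ 2 ∨ j * (j - 1) ≥ 2 := by
      rcases lt_or_gt_of_ne hj with h | h
      · right; nlinarith
      · left; nlinarith
    rcases h3 with h3 | h3
    · rw [zero_zpow _ (by omega), zero_mul]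
    · rw [zero_pow (by norm_num), zero_zpow (j * (j - 1) / 2) (by omega), mul_zero]

theorem qFacInf_base_zero (A : ℂ) : qFacInf A 0 = 1 - A := by
  have h : qFacInf 0 0 = 1 := by simp [qFacInf]
  simpa [qFac, h] using (qFac_mul_qFacInf A 0 (by simp) 1).symm

theorem mainTheorem2 (a x : ℂ) (ha : a ≠ 0) (hx : ‖x‖ < 1) :
    (∀ n : ℕ, qFac x (x ^ 2) (n + 1) * qFac (x ^ 4) (x ^ 4) n ≠ 0) ∧
    ramanujanPsi (-x) ≠ 0 ∧
    Summable (fun n : ℕ =>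
      qFac (-a * x) (x ^ 2) n * qFac (-x / a) (x ^ 2) n * x ^ (n ^ 2 + 2 * n) /
        (qFac x (x ^ 2) (n + 1) * qFac (x ^ 4) (x ^ 4) n)) ∧
    (1 + a) * ∑' n : ℕ,
      qFac (-a * x) (x ^ 2) n * qFac (-x / a) (x ^ 2) n * x ^ (n ^ 2 + 2 * n) /
        (qFac x (x ^ 2) (n + 1) * qFac (x ^ 4) (x ^ 4) n) =
    qFacInf (-a) (x ^ 4) * qFacInf (-x ^ 4 / a) (x ^ 4) * qFacInf (x ^ 4) (x ^ 4) /
      ramanujanPsi (-x) := by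
  have hQ := norm_sq_lt_one hx
  have hQ4 : ‖x ^ 4‖ < 1 := by
    rw [norm_pow]; exact pow_lt_one₀ (norm_nonneg _) hx (by norm_num)
  refine ⟨fun n => mul_ne_zero (qFac_ne_zero fun k _ => mul_pow_ne_one hx hQ k)
    (qFac_ne_zero fun k _ => mul_pow_ne_one hQ4 hQ4 k), ?_, summable_series hx, ?_⟩
  · rcases eq_or_ne x 0 with rfl | h0
    · rw [neg_zero, ramanujanPsi_zero]
      exact one_ne_zero
    · rw [ramanujanPsi_neg h0 hx]
      exact mul_ne_zero (qFacInf_ne_zero hQ (mul_pow_ne_one hx hQ))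
        (qFacInf_ne_zero hQ4 (mul_pow_ne_one hQ4 hQ4))
  rcases eq_or_ne x 0 with rfl | h0
  · rw [tsum_eq_single 0 (fun n hn => by
      rw [zero_pow (show n ^ 2 + 2 * n ≠ 0 by positivity), mul_zero, zero_div])]
    simp [qFac, ramanujanPsi_zero, qFacInf_base_zero]
  have hS := summable_double h0 hx ha
  have hJ := hasSum_tripleProduct (q := x ^ 2) (a := a / x ^ 2) (pow_ne_zero 2 h0) hQ
    (div_ne_zero ha (pow_ne_zero 2 h0))
  have hpos : qFacInf (-x) (x ^ 2) ≠ 0 := qFacInf_ne_zero hQ fun k => by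
    refine mul_pow_ne_one (by rwa [norm_neg]) hQ k
  have hK : qFacInf (-x) (x ^ 2) / qFacInf (x ^ 2) (x ^ 2) = (ramanujanPsi (-x))⁻¹ := by
    rw [qFacInf_sq hx, ramanujanPsi_neg h0 hx, mul_right_comm, mul_comm _ (qFacInf (-x) _),
      div_mul_cancel_left₀ hpos]
  rw [← tsum_mul_left, ← tsum_congr fun n => (hasSum_row h0 hx ha n).tsum_eq, ← hS.tsum_comm,
    tsum_congr fun j => ((hasSum_baileyTerm hx j).mul_left (a ^ j)).tsum_eq]
  have e : ∀ j : ℤ, a ^ j * (x ^ (2 * j ^ 2 - 2 * j) *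
      (qFacInf (-x) (x ^ 2) / qFacInf (x ^ 2) (x ^ 2))) =
      (a / x ^ 2) ^ j * (x ^ 2) ^ (j ^ 2) * (ramanujanPsi (-x))⁻¹ := fun j => by
    rw [hK, zpow_sub₀ h0, zpow_mul, zpow_mul, div_zpow, zpow_ofNat]
    ring
  rw [tsum_congr e, tsum_mul_right, hJ.tsum_eq, ← div_eq_mul_inv,
    show -(a / x ^ 2) * x ^ 2 = -a by field_simp,
    show -x ^ 2 / (a / x ^ 2) = -x ^ 4 / a by field_simp, show (x ^ 2) ^ 2 = x ^ 4 by ring]
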